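/- Let $V$ be a finite set. An \emph{mDAG} on $V$ is a pair $\mathfrak G=(\mathcal D,\mathcal B)$ of a directed acyclic graph $\mathcal D$ with node set $V$ and a simplicial complex $\mathcal B$ over $V$ (a family of subsets, the faces, that contains all singletons and is closed under taking subsets; the inclusion-maximal faces are the facets). \emph{Realizability.} The canonical pDAG $\mathrm{can}(\mathfrak G)$ has visible nodes $V$, one latent node $\ell_F$ for each facet $F$ of $\mathcal B$, the edges of $\mathcal D$, and the edges $\ell_F\to u$ for $u\in F$. For $\vec c\in\mathbb N^V$, a probability distribution $P$ on $\prod_{v\in V}\{1,\dots,c_v\}$ is realizable by $\mathfrak G$ if there are arbitrary finite cardinalities of the latent variables $X_\ell$ and of an error variable $E_a$ for each node $a$ (visible or latent) of $\mathrm{can}(\mathfrak G)$, functions $f_a$, and probability distributions $P(E_a)$, such that $$P(X_V)=\sum_{X_{\text{latent}}}\ \sum_{E}\ \prod_{a}\delta_{X_a,\,f_a(X_{\mathrm{pa}(a)},E_a)}\,P(E_a),$$ the product being over all nodes $a$ of $\mathrm{can}(\mathfrak G)$. A set of events $S\subseteq\prod_v\{1,\dots,c_v\}$ is a \emph{support realizable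 by} $\mathfrak G$ (at cardinalities $\vec c$) if $S=\{x: P(x)>0\}$ for some $P$ realizable by $\mathfrak G$. \emph{Dense connectedness.} For $S\subseteq V$, let two nodes of $S$ be adjacent in $S$ if some face contains both, and for $A\subseteq S$ let $\mathrm{dis}_S(A)$ be the set of nodes of $S$ that can be reached from $A$ by a (possibly trivial) path in $S$ of such adjacencies. Let $\mathrm{an}_S(A)$ be the set of nodes of $S$ from which a (possibly trivial) directed path of $\mathcal D$ inside $S$ leads to $A$. For $A\subseteq V$ put $A^{(0)}=V$, $A^{(i+1)}=\mathrm{dis}_{A^{(i)}}(A)$ for even $i$ and $A^{(i+1)}=\mathrm{an}_{A^{(i)}}(A)$ for odd $i$; the closure $\langle A\rangle_{\mathfrak G}$ is the eventual value of this decreasing sequence. Nodes $v\neq w$ are \emph{densely connected} in $\mathfrak G$ if $v$ is a parent of a node of $\langle\{w\}\rangle_{\mathfrak G}$, or $w$ is a parent of a node of $\langle\{v\}\rangle_{\mathfrak G}$, or any two nodes of $\langle\{v,w\}\rangle_{\mathfrak G}$ are connected by a path of adjacencies in $\langle\{v,w\}\rangle_{\mathfrak G}$. \textbf{Statement.} Let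 $\mathfrak G$ and $\mathfrak G'$ be mDAGs on $V$. Suppose that comparison of densely connected pairs shows that $\mathfrak G$ does not observationally dominate $\mathfrak G'$, i.e. some pair $v\ne w$ is densely connected in $\mathfrak G'$ but not in $\mathfrak G$. Then comparison of unrealizable supports shows it too: for some $\vec c$ there is a support that is realizable by $\mathfrak G'$ but not by $\mathfrak G$. In fact there is one with all visible variables binary, $\vec c=(2,\dots,2)$. Moreover, for every such pair $v,w$ a witness is the support of the distribution of binary variables in which $X_v=X_w$ is uniform and the remaining variables are uniform and independent of each other and of this pair: that support is realizable by $\mathfrak G'$ but not by $\mathfrak G$. -/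

import Mathlib

namespace CausalStructure

/-! ### DAGs and partitioned DAGs -/

/-- A directed acyclic graph on the node type `N`. -/
structure DAG (N : Type*) where
  /-- `edge u w` means that there is a directed edge `u → w`. -/
  edge : N → N → Prop
  acyclic : ∀ u, ¬ Relation.TransGen edge u u

/-- A partitioned DAG with visible nodes `V` (the nodes `Sum.inl v`) and latent nodes `L`
(the nodes `Sum.inr l`). -/
abbrev PDAG (V L : Type*) := DAG (V ⊕ L)

namespace DAG

variable {N : Type*}

/-- The parents of the elements of a set of nodes. -/
def parents (D : DAG N) (S : Set N) : Set N := {u | ∃ s ∈ S, D.edge u s}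

/-- The edge relation of the induced subgraph over `S`. -/
def inducedEdge (D : DAG N) (S : Set N) (u w : N) : Prop := u ∈ S ∧ w ∈ S ∧ D.edge u w

/-- The ancestors of the nodes of `A` in the induced subgraph over `S`; the nodes of `A` (that are
in `S`) count as ancestors of themselves. -/
def ancestorsIn (D : DAG N) (S A : Set N) : Set N :=
  {u | u ∈ S ∧ ∃ a ∈ A, a ∈ S ∧ Relation.ReflTransGen (D.inducedEdge S) u a}

end DAG

/-! ### Classical causal models on a partitioned DAG, realizable distributions and supports -/

/-- An assignment of values to the visible variables of cardinalities `c`. -/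
abbrev Event {V : Type*} (c : V → ℕ) := (v : V) → Fin (c v)

/-- The parameters of a classical causal model on the pDAG `G` whose visible variables have
cardinalities `c`: arbitrary finite cardinalities of the latent and of the error variables, a
function `f a` that determines the variable of the node `a` from its parents and from its error
variable, and a probability distribution of each error variable. -/
structure CausalModel {V L : Type*} (G : PDAG V L) (c : V → ℕ) where
  latCard : L → ℕ
  errCard : V ⊕ L → ℕ
  f : (a : V ⊕ L) → ((b : {b : V ⊕ L // G.edge b a}) → Fin (Sum.elim c latCard b.1)) →
    Fin (errCard a) → Fin (Sum.elim c latCard a)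
  errDist : (a : V ⊕ L) → Fin (errCard a) → ℝ
  errDist_mem : ∀ a, errDist a ∈ stdSimplex ℝ (Fin (errCard a))

/-- The joint assignment of values to all nodes given by `x` on the visible nodes and by `y` on the
latent nodes. -/
def jointValue {V L : Type*} {c : V → ℕ} {d : L → ℕ} (x : Event c) (y : Event d) :
    (a : V ⊕ L) → Fin (Sum.elim c d a)
  | Sum.inl v => x v
  | Sum.inr l => y l

open Classical in
/-- The distribution of the visible variables in a causal model,
`P(x) = ∑_y ∑_e ∏_a δ(x_a, f_a(x_pa(a), e_a)) P(e_a)`, where `y` runs over the values of the latent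
variables, `e` over the values of the error variables and `a` over all nodes. -/
noncomputable def CausalModel.visibleDist {V L : Type*} [Fintype V] [Fintype L] {G : PDAG V L}
    {c : V → ℕ} (M : CausalModel G c) (x : Event c) : ℝ :=
  ∑ y : Event M.latCard, ∑ e : Event M.errCard, ∏ a : V ⊕ L,
    (if jointValue x y a = M.f a (fun b => jointValue x y b.1) (e a) then 1 else 0)
      * M.errDist a (e a)

open Classical in
/-- The probability distributions on visible variables of cardinalities `c` that are realizable by
the pDAG `G`, under arbitrary finite cardinalities of the latent variables. -/
def PDAG.realizableDists {V L : Type*} [Fintype V] [Fintype L] (G : PDAG V L) (c : V → ℕ) :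
    Set (Event c → ℝ) :=
  {P | P ∈ stdSimplex ℝ (Event c) ∧ ∃ M : CausalModel G c, P = M.visibleDist}

/-- The support of a distribution: the set of events of nonzero probability. -/
def eventSupport {X : Type*} (P : X → ℝ) : Set X := {x | 0 < P x}

/-- The supports on visible variables of cardinalities `c` that are realizable by the pDAG `G`. -/
def PDAG.realizableSupports {V L : Type*} [Fintype V] [Fintype L] (G : PDAG V L) (c : V → ℕ) :
    Set (Set (Event c)) :=
  {S | ∃ P ∈ PDAG.realizableDists G c, eventSupport P = S}

/-! ### mDAGs -/

/-- An mDAG: a DAG on `V` (the directed structure) together with a simplicial complex over `V`.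
(In Mathlib's convention the empty set is not a face.) -/
structure MDAG (V : Type*) where
  directed : DAG V
  complex : AbstractSimplicialComplex V

namespace MDAG

variable {V : Type*}

/-- The facets of an mDAG: the inclusion-maximal faces of its simplicial complex. -/
def Facet (G : MDAG V) : Type _ := {F : Finset V // Maximal (fun A => A ∈ G.complex.faces) F}

noncomputable instance [Fintype V] (G : MDAG V) : Fintype G.Facet :=
  @Fintype.ofFinite _ (Subtype.finite)

/-- The edges of the canonical pDAG: the directed edges of the mDAG and, for each facet, edges from
the latent node of that facet to its elements. -/
inductive CanEdge (G : MDAG V) : V ⊕ G.Facet → V ⊕ G.Facet → Prop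
  | visible {u w : V} (h : G.directed.edge u w) : CanEdge G (Sum.inl u) (Sum.inl w)
  | latent {F : G.Facet} {w : V} (h : w ∈ F.1) : CanEdge G (Sum.inr F) (Sum.inl w)

theorem transGen_canEdge (G : MDAG V) {a b : V ⊕ G.Facet}
    (h : Relation.TransGen G.CanEdge a b) :
    ∃ w, b = Sum.inl w ∧ ∀ u, a = Sum.inl u → Relation.TransGen G.directed.edge u w := by
  induction h with
  | single h =>
    cases h with
    | visible h => exact ⟨_, rfl, fun u hu => by cases hu; exact .single h⟩
    | latent h => exact ⟨_, rfl, fun u hu => by cases hu⟩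
  | tail _ h ih =>
    obtain ⟨w, rfl, hw⟩ := ih
    cases h with
    | visible h => exact ⟨_, rfl, fun u hu => (hw u hu).tail h⟩

/-- The canonical pDAG of an mDAG: its latent nodes are the facets. -/
def can (G : MDAG V) : PDAG V G.Facet where
  edge := G.CanEdge
  acyclic a h := by
    obtain ⟨w, rfl, hw⟩ := G.transGen_canEdge h
    exact G.directed.acyclic w (hw w rfl)

/-- The supports that are realizable by an mDAG, that is, by its canonical pDAG. -/
def realizableSupports [Fintype V] (G : MDAG V) (c : V → ℕ) : Set (Set (Event c)) :=
  PDAG.realizableSupports G.can c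

/-! ### Districts, closure and dense connectedness -/

/-- Two nodes of `S` that lie in a common face, that is, that are adjacent through a facet of the
sub-mDAG over `S`. -/
def bidirectedIn (G : MDAG V) (S : Set V) (u w : V) : Prop :=
  u ∈ S ∧ w ∈ S ∧ ∃ B ∈ G.complex.faces, u ∈ B ∧ w ∈ B

/-- The union of the districts of the nodes of `A` in the sub-mDAG over `S`. -/
def districtIn (G : MDAG V) (S A : Set V) : Set V :=
  {u | u ∈ S ∧ ∃ a ∈ A, a ∈ S ∧ Relation.ReflTransGen (G.bidirectedIn S) a u}

/-- The sequence `A⁽⁰⁾ = nodes`, `A⁽ⁱ⁺¹⁾ = dis(A)` in the sub-mDAG over `A⁽ⁱ⁾` for even `i`, and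
`A⁽ⁱ⁺¹⁾ = an(A)` in the directed structure over `A⁽ⁱ⁾` for odd `i`. -/
def closureSeq (G : MDAG V) (A : Set V) : ℕ → Set V
  | 0 => Set.univ
  | i + 1 =>
    if i % 2 = 0 then G.districtIn (G.closureSeq A i) A
    else G.directed.ancestorsIn (G.closureSeq A i) A

/-- The closure `⟨A⟩`: the eventual value of the sequence `closureSeq`. That sequence is decreasing,
so that on a finite set of nodes its eventual value is its intersection. -/
def closure (G : MDAG V) (A : Set V) : Set V := ⋂ i, G.closureSeq A i

/-- Every node of `S` can be reached from every other through nodes of `S` that are connected by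
facets. -/
def BidirectedConnected (G : MDAG V) (S : Set V) : Prop :=
  ∀ u ∈ S, ∀ w ∈ S, Relation.ReflTransGen (G.bidirectedIn S) u w

/-- The pair of distinct nodes `v`, `w` is densely connected. -/
def DenselyConnected (G : MDAG V) (v w : V) : Prop :=
  v ≠ w ∧ (v ∈ G.directed.parents (G.closure {w}) ∨ w ∈ G.directed.parents (G.closure {v}) ∨
    G.BidirectedConnected (G.closure {v, w}))

/-! ### The two nondominance-proving rules -/

/-- Comparison of densely connected pairs shows that `G` does not observationally dominate `G'`:
some pair is densely connected in `G'` but not in `G`. -/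
def NondominanceByDensePairs (G G' : MDAG V) : Prop :=
  ∃ v w, v ≠ w ∧ G'.DenselyConnected v w ∧ ¬ G.DenselyConnected v w

/-- Comparison of unrealizable supports, for visible variables of cardinalities `c`, shows that `G`
does not observationally dominate `G'`: some support is realizable by `G'` but not by `G`. -/
def NondominanceBySupportsAt [Fintype V] (G G' : MDAG V) (c : V → ℕ) : Prop :=
  ∃ S : Set (Event c), S ∈ G'.realizableSupports c ∧ S ∉ G.realizableSupports c

/-- Comparison of unrealizable supports shows that `G` does not observationally dominate `G'`. -/
def NondominanceBySupports [Fintype V] (G G' : MDAG V) : Prop :=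
  ∃ c : V → ℕ, NondominanceBySupportsAt G G' c

end MDAG

/-- The cardinality vector `(2, 2, …, 2)`. -/
abbrev binaryCard (V : Type*) : V → ℕ := fun _ => 2

/-- The distribution of binary variables in which `X_v` and `X_w` are perfectly correlated (equal,
and uniformly distributed) and the remaining variables are uniform, independent of each other and of
this pair. -/
noncomputable def correlatedPairDist {V : Type*} [Fintype V] [DecidableEq V] (v w : V)
    (x : Event (binaryCard V)) : ℝ :=
  (if x v = x w then 1 / 2 else 0) * ∏ _u ∈ ({v, w} : Finset V)ᶜ, (1 / 2 : ℝ)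

end CausalStructure

namespace CausalStructure

/-! ### Acyclic relations and systems of equations on a DAG -/

/-! The support of the correlated pair is {x | x v = x w}, so the theorem says that this set is
realizable when the pair is densely connected and not realizable otherwise.

Realizable: let C be the closure that witnesses dense connectedness. It is connected by faces, so
latent bits shared inside facets give the nodes of C bits that range over all vectors of sum 0 and
no others (`sum_pairParity`, `exists_pairParity_eq`). Each node in exactly one of C and {v, w} has a
child in C, to which its value is added. Summing over C cancels everything except x v + x w = 0.

Not realizable: if a model has this support, the set C of all nodes forces equality: once the nodes
outside C are set by hand, x is possible on C iff x v = x w. Take w not to be an ancestor of v.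
Forcing survives passing to ancestors (`ForcesEq.ancestorsIn`) and to districts
(`ForcesEq.districtIn`), so it reaches the closure of {v, w}, and then the district of w in it,
which omits v. A minimal forcing set with w but without v lies in the closure of {w}, where v has no
child; so changing x v alone has no effect there, a contradiction. -/

theorem DAG.wellFounded {N : Type*} [Finite N] (D : DAG N) : WellFounded D.edge := by
  have : Std.Irrefl (Relation.TransGen D.edge) := ⟨D.acyclic⟩
  exact Subrelation.wf (fun h => Relation.TransGen.single h)
    (Finite.wellFounded_of_trans_of_irrefl (Relation.TransGen D.edge))

/-- A system of equations, one for each node of a finite DAG, in which the variable of each node is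
determined by those of its parents, has a unique solution. -/
theorem DAG.existsUnique_solution {N : Type*} [Finite N] (D : DAG N) {α : N → Type*}
    (f : (a : N) → ((b : {b : N // D.edge b a}) → α b.1) → α a) :
    ∃! z : (a : N) → α a, ∀ a, z a = f a (fun b => z b.1) := by
  refine ⟨D.wellFounded.fix (fun a ih => f a (fun b => ih b.1 b.2)),
    fun a => D.wellFounded.fix_eq _ a, fun z hz => funext fun a => ?_⟩
  induction a using D.wellFounded.induction with
  | _ a ih =>
    rw [hz a, D.wellFounded.fix_eq]
    exact congrArg (f a) (funext fun b => ih b.1 b.2)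

/-! ### Closures -/

namespace DAG

variable {N : Type*} (D : DAG N)

theorem ancestorsIn_subset (S A : Set N) : D.ancestorsIn S A ⊆ S := fun _ h => h.1

theorem ancestorsIn_mono {S T : Set N} (h : S ⊆ T) (A : Set N) :
    D.ancestorsIn S A ⊆ D.ancestorsIn T A := by
  rintro u ⟨hu, a, ha, haS, hp⟩
  exact ⟨h hu, a, ha, h haS, Relation.ReflTransGen.mono (fun _ _ e => ⟨h e.1, h e.2.1, e.2.2⟩) _ _ hp⟩

theorem mem_ancestorsIn_self {S A : Set N} {a : N} (haS : a ∈ S) (ha : a ∈ A) :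
    a ∈ D.ancestorsIn S A := ⟨haS, a, ha, haS, .refl⟩

theorem mem_ancestorsIn_of_edge {S A : Set N} {u a : N} (hu : u ∈ S) (e : D.edge u a)
    (ha : a ∈ D.ancestorsIn S A) : u ∈ D.ancestorsIn S A := by
  obtain ⟨haS, t, ht, htS, hp⟩ := ha
  exact ⟨hu, t, ht, htS, .head ⟨hu, haS, e⟩ hp⟩

end DAG

namespace MDAG

variable {V : Type*} (G : MDAG V)

theorem districtIn_subset (S A : Set V) : G.districtIn S A ⊆ S := fun _ h => h.1

theorem districtIn_mono {S T : Set V} (h : S ⊆ T) (A : Set V) :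
    G.districtIn S A ⊆ G.districtIn T A := by
  rintro u ⟨hu, a, ha, haS, hp⟩
  exact ⟨h hu, a, ha, h haS, Relation.ReflTransGen.mono (fun _ _ e => ⟨h e.1, h e.2.1, e.2.2⟩) _ _ hp⟩

theorem mem_districtIn_self {S A : Set V} {a : V} (haS : a ∈ S) (ha : a ∈ A) :
    a ∈ G.districtIn S A := ⟨haS, a, ha, haS, .refl⟩

theorem mem_districtIn_of_bidirectedIn {S A : Set V} {u a : V} (e : G.bidirectedIn S a u)
    (ha : a ∈ G.districtIn S A) : u ∈ G.districtIn S A := by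
  obtain ⟨haS, t, ht, htS, hp⟩ := ha
  exact ⟨e.2.1, t, ht, htS, hp.tail e⟩

theorem reflTransGen_bidirectedIn_symm {S : Set V} {u w : V}
    (h : Relation.ReflTransGen (G.bidirectedIn S) u w) :
    Relation.ReflTransGen (G.bidirectedIn S) w u :=
  have : Std.Symm (G.bidirectedIn S) :=
    ⟨fun _ _ ⟨h₁, h₂, B, hB, h₃, h₄⟩ => ⟨h₂, h₁, B, hB, h₄, h₃⟩⟩
  Relation.ReflTransGen.stdSymm.symm _ _ h

theorem closureSeq_antitone (A : Set V) : Antitone (G.closureSeq A) := by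
  refine antitone_nat_of_succ_le fun i => ?_
  rw [closureSeq]
  split_ifs
  · exact G.districtIn_subset _ _
  · exact G.directed.ancestorsIn_subset _ _

theorem exists_closureSeq_eq_closure [Finite V] (A : Set V) :
    ∃ n, ∀ m, n ≤ m → G.closureSeq A m = G.closure A := by
  obtain ⟨n, hn⟩ := WellFoundedGT.monotone_chain_condition
    (α := (Set V)ᵒᵈ) ⟨G.closureSeq A, fun _ _ h => G.closureSeq_antitone A h⟩
  have key : ∀ m, n ≤ m → G.closureSeq A m = G.closureSeq A n := fun m hm => (hn m hm).symm
  refine ⟨n, fun m hm => (key m hm).trans (subset_antisymm (Set.subset_iInter fun i => ?_)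
    (Set.iInter_subset _ n))⟩
  rcases le_total i n with h | h
  · exact G.closureSeq_antitone A h
  · exact (key i h).ge

theorem districtIn_closure [Finite V] (A : Set V) :
    G.districtIn (G.closure A) A = G.closure A := by
  obtain ⟨n, hn⟩ := G.exists_closureSeq_eq_closure A
  -- Beyond stabilization, the step from the even index 2n is a district step between two copies of
  -- the closure.
  have h := hn (2 * n + 1) (by omega)
  rwa [closureSeq, if_pos (by omega), hn (2 * n) (by omega)] at h

theorem ancestorsIn_closure [Finite V] (A : Set V) :
    G.directed.ancestorsIn (G.closure A) A = G.closure A := by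
  obtain ⟨n, hn⟩ := G.exists_closureSeq_eq_closure A
  have h := hn (2 * n + 1 + 1) (by omega)
  rwa [closureSeq, if_neg (by omega), hn (2 * n + 1) (by omega)] at h

/-- Both operations are monotone in the ambient set, so a set they do not shrink survives every
step. This makes the closure the largest such set. -/
theorem subset_closure_of_subset {A K : Set V} (hd : K ⊆ G.districtIn K A)
    (ha : K ⊆ G.directed.ancestorsIn K A) : K ⊆ G.closure A := by
  refine Set.subset_iInter fun i => ?_
  induction i with
  | zero => exact Set.subset_univ _
  | succ i ih =>
    rw [closureSeq]
    split_ifs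
    · exact hd.trans (G.districtIn_mono ih A)
    · exact ha.trans (G.directed.ancestorsIn_mono ih A)

theorem subset_closure (A : Set V) : A ⊆ G.closure A :=
  G.subset_closure_of_subset (fun _ h => G.mem_districtIn_self h h)
    (fun _ h => G.directed.mem_ancestorsIn_self h h)

/-- A node of the closure of `A` outside of `A` has a child in the closure. -/
theorem exists_edge_of_mem_closure [Finite V] {A : Set V} {a : V} (ha : a ∈ G.closure A)
    (haA : a ∉ A) : ∃ b ∈ G.closure A, G.directed.edge a b := by
  rw [← G.ancestorsIn_closure A] at ha
  obtain ⟨-, t, ht, -, hp⟩ := ha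
  rcases hp.cases_head with rfl | ⟨b, hb, -⟩
  · exact absurd ht haA
  · exact ⟨b, hb.2.1, hb.2.2⟩

theorem bidirectedConnected_closure_singleton [Finite V] (w : V) :
    G.BidirectedConnected (G.closure {w}) := by
  have key : ∀ u ∈ G.closure {w},
      Relation.ReflTransGen (G.bidirectedIn (G.closure {w})) w u := by
    intro u hu
    rw [← G.districtIn_closure {w}] at hu
    obtain ⟨-, t, rfl, -, hp⟩ := hu
    exact hp
  exact fun u hu u' hu' => (G.reflTransGen_bidirectedIn_symm (key u hu)).trans (key u' hu')

/-- If the closure of a pair is not connected, its two nodes lie in distinct districts of it. -/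
theorem notMem_districtIn_closure_pair [Finite V] {v w : V}
    (h : ¬ G.BidirectedConnected (G.closure {v, w})) :
    v ∉ G.districtIn (G.closure {v, w}) {w} := by
  rintro ⟨-, t, rfl, -, hp⟩
  have key : ∀ u ∈ G.closure {v, t},
      Relation.ReflTransGen (G.bidirectedIn (G.closure {v, t})) t u := by
    intro u hu
    rw [← G.districtIn_closure {v, t}] at hu
    obtain ⟨-, s, rfl | rfl, -, hs⟩ := hu
    · exact hp.trans hs
    · exact hs
  exact h fun u hu u' hu' => (G.reflTransGen_bidirectedIn_symm (key u hu)).trans (key u' hu')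

theorem DenselyConnected.symm {v w : V} (h : G.DenselyConnected v w) :
    G.DenselyConnected w v := by
  obtain ⟨hne, h⟩ := h
  refine ⟨hne.symm, ?_⟩
  rw [Set.pair_comm w v]
  tauto

theorem exists_facet_of_mem_faces [Finite V] {B : Finset V} (hB : B ∈ G.complex.faces) :
    ∃ F : G.Facet, B ⊆ F.1 := by
  obtain ⟨F, hBF, hF⟩ := Finite.exists_le_maximal (p := fun A => A ∈ G.complex.faces) hB
  exact ⟨⟨F, hF⟩, hBF⟩

end MDAG

/-! ### Supports of causal models -/

theorem CausalModel.existsUnique_values {V L : Type*} [Finite V] [Finite L] {G : PDAG V L}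
    {c : V → ℕ} (M : CausalModel G c) (e : Event M.errCard) :
    ∃! p : Event c × Event M.latCard, ∀ a, jointValue p.1 p.2 a =
      M.f a (fun b => jointValue p.1 p.2 b.1) (e a) := by
  obtain ⟨z, hz, hu⟩ := G.existsUnique_solution (fun a p => M.f a p (e a))
  have hj : ∀ z : (a : V ⊕ L) → Fin (Sum.elim c M.latCard a),
      jointValue (fun v => z (Sum.inl v)) (fun l => z (Sum.inr l)) = z := by
    intro z
    funext a
    cases a <;> rfl
  refine ⟨(fun v => z (Sum.inl v), fun l => z (Sum.inr l)), ?_, ?_⟩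
  · have key : ∀ z', z' = z → ∀ a, z' a = M.f a (fun b => z' b.1) (e a) := by
      rintro _ rfl
      exact hz
    exact key _ (hj z)
  · rintro ⟨x, y⟩ hxy
    have := hu (jointValue x y) hxy
    subst this
    rfl

open Classical in
theorem CausalModel.visibleDist_eq {V L : Type*} [Fintype V] [Fintype L] {G : PDAG V L}
    {c : V → ℕ} (M : CausalModel G c) (x : Event c) :
    M.visibleDist x = ∑ y : Event M.latCard, ∑ e : Event M.errCard,
      (if ∀ a, jointValue x y a = M.f a (fun b => jointValue x y b.1) (e a) then 1 else 0) *
        ∏ a, M.errDist a (e a) := by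
  refine Finset.sum_congr rfl fun y _ => Finset.sum_congr rfl fun e _ => ?_
  rw [Finset.prod_mul_distrib, Finset.prod_ite_zero]
  simp

-- Each error vector determines exactly one assignment, so the total mass is the product of the
-- masses of the error distributions.
open Classical in
theorem CausalModel.visibleDist_mem_stdSimplex {V L : Type*} [Fintype V] [Fintype L]
    {G : PDAG V L} {c : V → ℕ} (M : CausalModel G c) :
    M.visibleDist ∈ stdSimplex ℝ (Event c) := by
  classical
  constructor
  · intro x
    rw [M.visibleDist_eq]
    refine Finset.sum_nonneg fun y _ => Finset.sum_nonneg fun e _ => mul_nonneg ?_ ?_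
    · split_ifs <;> norm_num
    · exact Finset.prod_nonneg fun a _ => (M.errDist_mem a).1 _
  · simp only [M.visibleDist_eq]
    rw [← Fintype.sum_prod_type', Finset.sum_comm]
    simp only [← Finset.sum_mul]
    have h1 : ∀ e : Event M.errCard, ∑ p : Event c × Event M.latCard,
        (if ∀ a, jointValue p.1 p.2 a = M.f a (fun b => jointValue p.1 p.2 b.1) (e a)
          then (1 : ℝ) else 0) = 1 := by
      intro e
      obtain ⟨p, hp, hu⟩ := M.existsUnique_values e
      rw [Finset.sum_eq_single p (fun q _ hq => if_neg fun h => hq (hu q h)) (by simp), if_pos hp]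
    simp only [h1, one_mul]
    rw [← Fintype.prod_sum M.errDist]
    exact Finset.prod_eq_one fun a _ => (M.errDist_mem a).2

theorem CausalModel.visibleDist_pos_iff {V L : Type*} [Fintype V] [Fintype L]
    {G : PDAG V L} {c : V → ℕ} (M : CausalModel G c) (x : Event c) :
    0 < M.visibleDist x ↔ ∃ (y : Event M.latCard) (e : Event M.errCard),
      (∀ a, 0 < M.errDist a (e a)) ∧
        ∀ a, jointValue x y a = M.f a (fun b => jointValue x y b.1) (e a) := by
  classical
  have hnn : ∀ e : Event M.errCard, 0 ≤ ∏ a, M.errDist a (e a) :=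
    fun e => Finset.prod_nonneg fun a _ => (M.errDist_mem a).1 _
  rw [M.visibleDist_eq]
  constructor
  · intro h
    obtain ⟨y, -, hy⟩ := Finset.exists_lt_of_sum_lt (Finset.sum_const_zero.trans_lt h)
    obtain ⟨e, -, he⟩ := Finset.exists_lt_of_sum_lt (Finset.sum_const_zero.trans_lt hy)
    split_ifs at he with hc
    · refine ⟨y, e, fun a => lt_of_le_of_ne ((M.errDist_mem a).1 _) fun h0 => ?_, hc⟩
      rw [Finset.prod_eq_zero (Finset.mem_univ a) h0.symm] at he
      simp at he
    · simp at he
  · rintro ⟨y, e, hpos, hc⟩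
    refine Finset.sum_pos' (fun y _ => Finset.sum_nonneg fun e _ => mul_nonneg ?_ (hnn e))
      ⟨y, Finset.mem_univ _, Finset.sum_pos' (fun e _ => mul_nonneg ?_ (hnn e))
        ⟨e, Finset.mem_univ _, ?_⟩⟩
    · split_ifs <;> norm_num
    · split_ifs <;> norm_num
    · rw [if_pos hc, one_mul]
      exact Finset.prod_pos fun a _ => hpos a

theorem eventSupport_correlatedPairDist {V : Type*} [Fintype V] [DecidableEq V] (v w : V) :
    eventSupport (correlatedPairDist v w) = {x | x v = x w} := by
  ext x
  have h : (0 : ℝ) < ∏ _u ∈ ({v, w} : Finset V)ᶜ, (1 / 2 : ℝ) :=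
    Finset.prod_pos fun _ _ => by norm_num
  by_cases hx : x v = x w
  · simp [eventSupport, correlatedPairDist, hx]
  · simp [eventSupport, correlatedPairDist, hx]

/-! ### Local solutions of causal models of mDAGs -/

namespace MDAG

variable {V : Type*} {G : MDAG V} {c : V → ℕ}

/-- The values of the latent variables of the canonical pDAG, given those of the error
variables. -/
def latentValue (M : CausalModel G.can c) (e : Event M.errCard) : Event M.latCard :=
  fun F => M.f (Sum.inr F) (fun b => False.elim (by obtain ⟨_, h⟩ := b; cases h)) (e (Sum.inr F))

/-- The equation of the visible node `a` holds for the visible values `x` and the error values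
`e`. -/
def EquationAt (M : CausalModel G.can c) (e : Event M.errCard) (x : Event c) (a : V) : Prop :=
  x a = M.f (Sum.inl a) (fun b => jointValue x (latentValue M e) b.1) (e (Sum.inl a))

/-- For some values of positive probability of the error variables, the equations of the nodes of
`C` hold for `x`: that is, the values of `x` on `C` are possible when the remaining nodes are set to
their values in `x`. -/
def PossibleOn (M : CausalModel G.can c) (C : Set V) (x : Event c) : Prop :=
  ∃ e : Event M.errCard, (∀ b, 0 < M.errDist b (e b)) ∧ ∀ a ∈ C, EquationAt M e x a

theorem visibleDist_pos_iff_possibleOn_univ [Fintype V] (M : CausalModel G.can c) (x : Event c) :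
    0 < M.visibleDist x ↔ PossibleOn M Set.univ x := by
  rw [M.visibleDist_pos_iff]
  constructor
  · rintro ⟨y, e, hpos, h⟩
    have hy : y = latentValue M e := funext fun F => (h (Sum.inr F)).trans
      (congrArg (fun p => M.f (Sum.inr F) p _) (funext fun b => by obtain ⟨_, h⟩ := b; cases h))
    subst hy
    exact ⟨e, hpos, fun a _ => h (Sum.inl a)⟩
  · rintro ⟨e, hpos, h⟩
    refine ⟨latentValue M e, e, hpos, fun a => ?_⟩
    rcases a with a | F
    · exact h a (Set.mem_univ a)
    · exact congrArg (fun p => M.f (Sum.inr F) p _)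
        (funext fun b => by obtain ⟨_, h⟩ := b; cases h)

theorem PossibleOn.mono {M : CausalModel G.can c} {C C' : Set V} {x : Event c} (h : C' ⊆ C)
    (hx : PossibleOn M C x) : PossibleOn M C' x := by
  obtain ⟨e, hpos, he⟩ := hx
  exact ⟨e, hpos, fun a ha => he a (h ha)⟩

theorem EquationAt.congr {M : CausalModel G.can c} {e e' : Event M.errCard} {x x' : Event c}
    {a : V} (h : EquationAt M e x a) (hx : ∀ b, G.directed.edge b a → x b = x' b)
    (hxa : x a = x' a) (hF : ∀ F : G.Facet, a ∈ F.1 → e (Sum.inr F) = e' (Sum.inr F))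
    (hea : e (Sum.inl a) = e' (Sum.inl a)) : EquationAt M e' x' a := by
  rw [EquationAt, ← hxa, ← hea]
  refine h.trans (congrArg (fun p => M.f (Sum.inl a) p _) (funext fun b => ?_))
  obtain ⟨b, hb⟩ := b
  cases hb with
  | visible hb => exact hx _ hb
  | latent hb => exact congrArg (M.f _ _) (hF _ hb)

open Classical in
/-- For any error values and any values of the nodes outside of `C`, the equations of the nodes of
`C` have a solution. -/
theorem exists_solutionOn [Finite V] (M : CausalModel G.can c) (e : Event M.errCard) (C : Set V)
    (x : Event c) : ∃ z : Event c, (∀ a ∉ C, z a = x a) ∧ ∀ a ∈ C, EquationAt M e z a := by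
  have : Finite G.Facet := Subtype.finite
  obtain ⟨z, hz, -⟩ := G.can.existsUnique_solution (α := Sum.elim (fun v => Fin (c v)) _)
    (fun a => match a with
      | Sum.inl a => fun p => if a ∈ C then
          M.f (Sum.inl a) (fun b => match b with
            | ⟨Sum.inl b, h⟩ => p ⟨Sum.inl b, h⟩
            | ⟨Sum.inr F, _⟩ => latentValue M e F) (e (Sum.inl a)) else x a
      | Sum.inr F => fun _ => latentValue M e F)
  refine ⟨fun a => z (Sum.inl a), fun a ha => (hz (Sum.inl a)).trans (if_neg ha), fun a ha => ?_⟩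
  refine (hz (Sum.inl a)).trans ((if_pos ha).trans ?_)
  refine congrArg (fun p => M.f (Sum.inl a) p _) (funext fun b => ?_)
  obtain ⟨b | F, hb⟩ := b <;> rfl

/-- On `C`, given any values of the remaining nodes, exactly those values are possible that satisfy
`x v = x w`. -/
def ForcesEq (M : CausalModel G.can (binaryCard V)) (v w : V) (C : Set V) : Prop :=
  ∀ x, PossibleOn M C x ↔ x v = x w

/-! ### Shrinking a set that forces equality -/

variable {M : CausalModel G.can (binaryCard V)} {v w : V} {C A : Set V}

/-- An ancestral subset of C never reads the rest of C, so the rest can be solved afterwards without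
disturbing the subset or the values of v and w. -/
theorem ForcesEq.ancestorsIn [Finite V] (h : ForcesEq M v w C)
    (hw : w ∈ G.directed.ancestorsIn C A)
    (hv : v ∈ G.directed.ancestorsIn C A ∨ v ∉ C) :
    ForcesEq M v w (G.directed.ancestorsIn C A) := by
  refine fun x => ⟨?_, fun hx => ((h x).2 hx).mono (G.directed.ancestorsIn_subset C A)⟩
  rintro ⟨e, hpos, he⟩
  obtain ⟨z, hz, hze⟩ := exists_solutionOn M e (C \ G.directed.ancestorsIn C A) x
  have hvz : z v = x v := hz v fun h => hv.elim h.2 fun h' => h' h.1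
  have hwz : z w = x w := hz w fun h => h.2 hw
  rw [← hvz, ← hwz]
  refine (h z).1 ⟨e, hpos, fun a ha => ?_⟩
  by_cases haA : a ∈ G.directed.ancestorsIn C A
  · refine (he a haA).congr (fun b hb => ?_) (hz a fun h => h.2 haA).symm (fun _ _ => rfl) rfl
    exact (hz b fun h => h.2 (G.directed.mem_ancestorsIn_of_edge h.1 hb haA)).symm
  · exact hze a ⟨ha, haA⟩

-- Distinct districts of C share no latent variable, so error values for the district and for the
-- rest of C can be chosen independently and glued.
open Classical in
theorem ForcesEq.districtIn [Finite V] (h : ForcesEq M v w C) (hwC : w ∈ C) (hne : v ≠ w)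
    (hwv : ¬ Relation.TransGen G.directed.edge w v) (hw : w ∈ G.districtIn C A) :
    ForcesEq M v w (G.districtIn C A) := by
  refine fun x => ⟨?_, fun hx => ((h x).2 hx).mono (G.districtIn_subset C A)⟩
  rintro ⟨e, hpos, he⟩
  set C' := G.districtIn C A with hC'
  -- Resetting x at w to x v makes the event possible on C. Its errors serve outside the district;
  -- the change at w is invisible to non-descendants of w.
  obtain ⟨e', hpos', he'⟩ := (h (Function.update x w (x v))).2 (by simp [hne])
  let e'' : Event M.errCard := fun b => match b with
    | Sum.inl a => if a ∈ C' then e (Sum.inl a) else e' (Sum.inl a)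
    | Sum.inr F => if ∃ a ∈ C', a ∈ F.1 then e (Sum.inr F) else e' (Sum.inr F)
  have hpos'' : ∀ b, 0 < M.errDist b (e'' b) := by
    rintro (a | F) <;> dsimp only [e''] <;> split_ifs
    exacts [hpos _, hpos' _, hpos _, hpos' _]
  obtain ⟨z, hz, hze⟩ := exists_solutionOn M e'' C x
  -- The solution for the glued errors may differ from x below w, but not elsewhere; neither v nor w
  -- is a proper descendant of w.
  have key : ∀ a, ¬ Relation.TransGen G.directed.edge w a → z a = x a := by
    intro a
    induction a using G.directed.wellFounded.induction with
    | _ a ih =>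
      intro ha
      by_cases haC : a ∈ C
      swap
      · exact hz a haC
      have hpar : ∀ b, G.directed.edge b a → b ≠ w ∧ z b = x b := by
        intro b hb
        have hbw : b ≠ w := by
          rintro rfl
          exact ha (.single hb)
        exact ⟨hbw, ih b hb fun hwb => ha (hwb.tail hb)⟩
      have hfin : EquationAt M e'' x a := by
        by_cases haC' : a ∈ C'
        · refine (he a haC').congr (fun _ _ => rfl) rfl (fun F hF => ?_) ?_
          · exact (if_pos ⟨a, haC', hF⟩).symm
          · exact (if_pos haC').symm
        · have haw : a ≠ w := by
            rintro rfl
            exact haC' hw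
          refine (he' a haC).congr (fun b hb => Function.update_of_ne (hpar b hb).1 _ _)
            (Function.update_of_ne haw _ _) (fun F hF => (if_neg ?_).symm) (if_neg haC').symm
          -- A facet through a that met the district would put a in the district.
          rintro ⟨u, hu, huF⟩
          exact haC' (G.mem_districtIn_of_bidirectedIn
            ⟨G.districtIn_subset C A hu, haC, F.1, F.2.prop, huF, hF⟩ hu)
      refine (hze a haC).trans (Eq.trans ?_ hfin.symm)
      refine congrArg (fun p => M.f (Sum.inl a) p _) (funext fun b => ?_)
      obtain ⟨b, hb⟩ := b
      cases hb with
      | visible hb => exact (hpar _ hb).2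
      | latent hb => rfl
  rw [← key v hwv, ← key w (G.directed.acyclic w)]
  exact (h z).1 ⟨e'', hpos'', hze⟩

theorem not_forcesEq_univ_of_not_transGen [Finite V] (hne : v ≠ w)
    (hvw : ¬ G.DenselyConnected v w) (hwv : ¬ Relation.TransGen G.directed.edge w v) :
    ¬ ForcesEq M v w Set.univ := by
  intro h0
  have hpar : v ∉ G.directed.parents (G.closure {w}) := fun h => hvw ⟨hne, .inl h⟩
  have hcon : ¬ G.BidirectedConnected (G.closure {v, w}) := fun h => hvw ⟨hne, .inr (.inr h)⟩
  -- The closure of the pair forces equality.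
  have h1 : ForcesEq M v w (G.closure {v, w}) := by
    suffices ∀ i, ForcesEq M v w (G.closureSeq {v, w} i) by
      obtain ⟨n, hn⟩ := G.exists_closureSeq_eq_closure {v, w}
      exact hn n le_rfl ▸ this n
    have hmem : ∀ i, ({v, w} : Set V) ⊆ G.closureSeq {v, w} i :=
      fun i => (G.subset_closure _).trans (Set.iInter_subset _ i)
    intro i
    induction i with
    | zero => exact h0
    | succ i ih =>
      have hv := hmem (i + 1) (Set.mem_insert v {w})
      have hw := hmem (i + 1) (Set.mem_insert_of_mem v rfl)
      rw [closureSeq] at hv hw ⊢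
      split_ifs at hv hw ⊢
      · exact ih.districtIn (hmem i (Set.mem_insert_of_mem v rfl)) hne hwv hw
      · exact ih.ancestorsIn hw (.inl hv)
  have hwC : w ∈ G.closure {v, w} := G.subset_closure _ (Set.mem_insert_of_mem v rfl)
  have hwD : w ∈ G.districtIn (G.closure {v, w}) {w} := G.mem_districtIn_self hwC rfl
  have h2 := h1.districtIn hwC hne hwv hwD
  -- A minimal set that contains `w` but not `v` and forces equality.
  obtain ⟨K, -, hK⟩ := Finite.exists_le_minimal
    (p := fun K : Set V => w ∈ K ∧ v ∉ K ∧ ForcesEq M v w K)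
    ⟨hwD, G.notMem_districtIn_closure_pair hcon, h2⟩
  obtain ⟨hwK, hvK, h3⟩ := hK.prop
  -- By minimality of K, neither operation applied to {w} can shrink it.
  have hd : K ⊆ G.districtIn K {w} := by
    have hw := G.mem_districtIn_self hwK (Set.mem_singleton w)
    have hs := G.districtIn_subset K {w}
    exact hK.le_of_le ⟨hw, fun h => hvK (hs h), h3.districtIn hwK hne hwv hw⟩ hs
  have ha : K ⊆ G.directed.ancestorsIn K {w} := by
    have hw := G.directed.mem_ancestorsIn_self hwK (Set.mem_singleton w)
    have hs := G.directed.ancestorsIn_subset K {w}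
    exact hK.le_of_le ⟨hw, fun h => hvK (hs h), h3.ancestorsIn hw (.inr hvK)⟩ hs
  have hKc := G.subset_closure_of_subset hd ha
  classical
  -- The zero event is possible on K. Flipping only v keeps it possible, as v is neither in K nor a
  -- parent of K, although it breaks equality.
  obtain ⟨e, hpos, he⟩ := (h3 fun _ => 0).2 rfl
  have hflip := (h3 (Function.update (fun _ => 0) v 1)).1 ⟨e, hpos, fun a haK => ?_⟩
  · simp [hne.symm] at hflip
  · refine (he a haK).congr (fun b hb => ?_) ?_ (fun _ _ => rfl) rfl
    · have hbv : b ≠ v := by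
        rintro rfl
        exact hpar ⟨a, hKc haK, hb⟩
      rw [Function.update_of_ne hbv]
    · have hav : a ≠ v := by
        rintro rfl
        exact hvK haK
      rw [Function.update_of_ne hav]

/-- If a pair is not densely connected, then no causal model makes exactly those events possible in
which the two variables are equal. -/
theorem not_forcesEq_univ [Finite V] (hne : v ≠ w) (hvw : ¬ G.DenselyConnected v w) :
    ¬ ForcesEq M v w Set.univ := by
  by_cases hwv : Relation.TransGen G.directed.edge w v
  · intro h
    exact not_forcesEq_univ_of_not_transGen (M := M) hne.symm (fun h => hvw h.symm)
      (fun h => G.directed.acyclic w (hwv.trans h)) fun x => (h x).trans eq_comm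
  · exact not_forcesEq_univ_of_not_transGen hne hvw hwv

theorem notMem_realizableSupports [Fintype V] (hne : v ≠ w) (hvw : ¬ G.DenselyConnected v w) :
    {x : Event (binaryCard V) | x v = x w} ∉ G.realizableSupports (binaryCard V) := by
  rintro ⟨_, ⟨-, M, rfl⟩, hS⟩
  exact not_forcesEq_univ (M := M) hne hvw fun x =>
    (visibleDist_pos_iff_possibleOn_univ M x).symm.trans (Set.ext_iff.1 hS x)

end MDAG

/-! ### Realization of the support of a correlated pair -/

namespace MDAG

open Classical in
/-- The events that solve a system of local equations, with arbitrary latent values in a finite type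
`Λ` and arbitrary binary errors, form a realizable support. -/
theorem setOf_solution_mem_realizableSupports {V : Type*} [Fintype V] (G : MDAG V) {Λ : Type*}
    [Fintype Λ] [Nonempty Λ] (g : V → (V → Fin 2) → (G.Facet → Λ) → Fin 2 → Fin 2)
    (hx : ∀ a x x' u e, (∀ b, G.directed.edge b a → x b = x' b) → g a x u e = g a x' u e)
    (hu : ∀ a x u u' e, (∀ F : G.Facet, a ∈ F.1 → u F = u' F) → g a x u e = g a x u' e) :
    {x : Event (binaryCard V) | ∃ (u : G.Facet → Λ) (e : V → Fin 2), ∀ a, x a = g a x u (e a)} ∈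
      G.realizableSupports (binaryCard V) := by
  let q := Fintype.equivFin Λ
  have hq : 0 < Fintype.card Λ := Fintype.card_pos
  let M : CausalModel G.can (binaryCard V) :=
    { latCard := fun _ => Fintype.card Λ
      errCard := Sum.elim (fun _ => 2) fun _ => Fintype.card Λ
      f := fun a => match a with
        | Sum.inl a => fun p e => g a
            -- The defaults at non-parents are harmless: `hx` and `hu` say that `g a` ignores them.
            (fun b => if h : G.can.edge (Sum.inl b) (Sum.inl a) then p ⟨Sum.inl b, h⟩ else 0)
            (fun F => q.symm (if h : G.can.edge (Sum.inr F) (Sum.inl a) then p ⟨Sum.inr F, h⟩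
              else ⟨0, hq⟩)) e
        | Sum.inr F => fun _ e => e
      errDist := fun a _ => ((Sum.elim (fun _ => 2) (fun _ => Fintype.card Λ) a : ℕ) : ℝ)⁻¹
      errDist_mem := by
        have hsum : ∀ n : ℕ, n ≠ 0 → ∑ _i : Fin n, (n : ℝ)⁻¹ = 1 := fun n hn => by simp [hn]
        rintro (a | F)
        · exact ⟨fun _ => by positivity, hsum 2 two_ne_zero⟩
        · exact ⟨fun _ => by positivity, hsum _ hq.ne'⟩ }
  have hpos : ∀ a e, 0 < M.errDist a e := by
    rintro (a | F) e
    · exact inv_pos.2 (by simp)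
    · exact inv_pos.2 (by simpa using hq)
  refine ⟨M.visibleDist, ⟨M.visibleDist_mem_stdSimplex, M, rfl⟩, Set.ext fun x => ?_⟩
  have hM : ∀ (y : Event M.latCard) (a : V) (e : Fin 2),
      M.f (Sum.inl a) (fun b => jointValue x y b.1) e = g a x (fun F => q.symm (y F)) e := by
    intro y a e
    refine (hx a _ x _ e fun b hb => ?_).trans (hu a x _ _ e fun F hF => ?_)
    · exact dif_pos (CanEdge.visible hb)
    · exact congrArg q.symm (dif_pos (CanEdge.latent hF))
  refine (M.visibleDist_pos_iff x).trans ⟨?_, ?_⟩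
  · rintro ⟨y, e, -, h⟩
    exact ⟨fun F => q.symm (y F), fun a => e (Sum.inl a),
      fun a => (h (Sum.inl a)).trans (hM y a _)⟩
  · rintro ⟨u, e, h⟩
    refine ⟨fun F => q (u F), fun a => match a with
      | Sum.inl a => e a
      | Sum.inr F => q (u F), fun a => hpos a _, fun a => ?_⟩
    rcases a with a | F
    · refine (h a).trans ?_
      rw [hM]
      simp
    · rfl

/-! ### Parity bits distributed by the latent nodes -/

variable {V : Type*} [Fintype V] (G : MDAG V)

open Classical in
/-- The sum, over the facets `F ∋ a` and the nodes `b` of `C ∩ F`, of the bits that `F` assigns to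
the pair of `a` and `b`. -/
noncomputable def pairParity (C : Finset V) (u : G.Facet → V → V → ZMod 2) (a : V) : ZMod 2 :=
  ∑ F : G.Facet, ∑ b ∈ C, if a ∈ F.1 ∧ b ∈ F.1 then u F a b + u F b a else 0

/-- The summand is symmetric in the two nodes, so each bit is counted twice and cancels modulo 2. -/
theorem sum_pairParity (C : Finset V) (u : G.Facet → V → V → ZMod 2) :
    ∑ a ∈ C, G.pairParity C u a = 0 := by
  classical
  simp only [pairParity]
  rw [Finset.sum_comm]
  refine Finset.sum_eq_zero fun F _ => ?_
  have h : ∀ a b, (if a ∈ F.1 ∧ b ∈ F.1 then u F a b + u F b a else 0) =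
      (if a ∈ F.1 ∧ b ∈ F.1 then u F a b else 0) + if b ∈ F.1 ∧ a ∈ F.1 then u F b a else 0 := by
    intro a b
    by_cases ha : a ∈ F.1 <;> by_cases hb : b ∈ F.1 <;> simp [ha, hb]
  simp only [h, Finset.sum_add_distrib]
  rw [Finset.sum_comm (s := C) (t := C)]
  exact CharTwo.add_self_eq_zero _

theorem pairParity_congr (C : Finset V) {u u' : G.Facet → V → V → ZMod 2} {a : V}
    (h : ∀ F : G.Facet, a ∈ F.1 → u F = u' F) : G.pairParity C u a = G.pairParity C u' a := by
  classical
  refine Finset.sum_congr rfl fun F _ => Finset.sum_congr rfl fun b _ => ?_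
  by_cases ha : a ∈ F.1
  · rw [h F ha]
  · simp [ha]

theorem pairParity_add (C : Finset V) (u u' : G.Facet → V → V → ZMod 2) (a : V) :
    G.pairParity C (u + u') a = G.pairParity C u a + G.pairParity C u' a := by
  classical
  simp only [pairParity, ← Finset.sum_add_distrib]
  refine Finset.sum_congr rfl fun F _ => Finset.sum_congr rfl fun b _ => ?_
  split_ifs
  · simp only [Pi.add_apply]
    ring
  · simp

theorem pairParity_sum_smul (C : Finset V) {ι : Type*} (s : Finset ι) (r : ι → ZMod 2)
    (u : ι → G.Facet → V → V → ZMod 2) (a : V) :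
    G.pairParity C (∑ i ∈ s, r i • u i) a = ∑ i ∈ s, r i * G.pairParity C (u i) a := by
  classical
  have hsmul : ∀ (r : ZMod 2) (u : G.Facet → V → V → ZMod 2),
      G.pairParity C (r • u) a = r * G.pairParity C u a := by
    intro r u
    simp only [pairParity, Finset.mul_sum]
    refine Finset.sum_congr rfl fun F _ => Finset.sum_congr rfl fun b _ => ?_
    split_ifs
    · simp only [Pi.smul_apply, smul_eq_mul]
      ring
    · simp
  induction s using Finset.induction_on with
  | empty => simpa using hsmul 0 0
  | insert i s hi ih => rw [Finset.sum_insert hi, Finset.sum_insert hi, pairParity_add, hsmul, ih]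

open Classical in
/-- In a connected set, the parity of any two nodes can be flipped. -/
theorem exists_pairParity_eq_ite_add_ite {C : Finset V} {a b : V}
    (h : Relation.ReflTransGen (G.bidirectedIn C) a b) :
    ∃ u, ∀ d ∈ C, G.pairParity C u d = (if d = a then 1 else 0) + if d = b then 1 else 0 := by
  induction h with
  | refl =>
    refine ⟨0, fun d _ => ?_⟩
    rw [CharTwo.add_self_eq_zero]
    simp [pairParity]
  | @tail b t _ hbt ih =>
    obtain ⟨u, hu⟩ := ih
    obtain ⟨hb, ht, B, hB, hbB, htB⟩ := hbt
    -- A single bit in a facet containing b and t flips exactly these two; adding it moves the end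
    -- of the path from b to t.
    obtain ⟨F, hF⟩ := G.exists_facet_of_mem_faces hB
    have hu' : ∀ d ∈ C, G.pairParity C
        (fun F' x y => if F' = F ∧ x = b ∧ y = t then 1 else 0) d =
          (if d = b then 1 else 0) + if d = t then 1 else 0 := by
      intro d hd
      rw [pairParity, Finset.sum_eq_single F (fun F' _ hF' => by simp [hF']) (by simp)]
      have h2 : ∀ y, (if d ∈ F.1 ∧ y ∈ F.1 then
          (if F = F ∧ d = b ∧ y = t then (1 : ZMod 2) else 0) +
            (if F = F ∧ y = b ∧ d = t then 1 else 0) else 0) =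
          (if y = t then (if d = b then 1 else 0) else 0) +
            if y = b then (if d = t then 1 else 0) else 0 := by
        intro y
        have := hF hbB
        have := hF htB
        by_cases h1 : d = b <;> by_cases h2 : d = t <;> by_cases h3 : y = t <;>
          by_cases h4 : y = b <;> subst_vars <;> simp_all
      have hb : b ∈ C := hb
      have ht : t ∈ C := ht
      rw [Finset.sum_congr rfl fun y _ => h2 y, Finset.sum_add_distrib, Finset.sum_ite_eq',
        Finset.sum_ite_eq', if_pos hb, if_pos ht]
    refine ⟨u + fun F' x y => if F' = F ∧ x = b ∧ y = t then 1 else 0, fun d hd => ?_⟩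
    rw [G.pairParity_add C u, hu d hd, hu' d hd, add_assoc, ← add_assoc (if d = b then _ else _),
      CharTwo.add_self_eq_zero, zero_add]

/-- In a connected set, the pair parities assume all values of even sum. -/
theorem exists_pairParity_eq {C : Finset V} (hC : G.BidirectedConnected C) (y : V → ZMod 2)
    (hy : ∑ a ∈ C, y a = 0) : ∃ u, ∀ a ∈ C, G.pairParity C u a = y a := by
  classical
  rcases C.eq_empty_or_nonempty with rfl | ⟨t, ht⟩
  · exact ⟨0, by simp⟩
  have key : ∀ b : V, ∃ u, b ∈ C → ∀ d ∈ C, G.pairParity C u d =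
      (if d = b then 1 else 0) + if d = t then 1 else 0 := by
    intro b
    by_cases hb : b ∈ C
    · obtain ⟨u, hu⟩ := G.exists_pairParity_eq_ite_add_ite (hC b hb t ht)
      exact ⟨u, fun _ => hu⟩
    · exact ⟨0, fun h => absurd h hb⟩
  choose u hu using key
  -- Flipping b together with t whenever y b = 1 is right away from t; at t the surplus is the sum
  -- of y, which vanishes.
  refine ⟨∑ b ∈ C, y b • u b, fun d hd => ?_⟩
  rw [pairParity_sum_smul]
  calc ∑ b ∈ C, y b * G.pairParity C (u b) d
      = ∑ b ∈ C, ((if d = b then y b else 0) + y b * if d = t then 1 else 0) := by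
        refine Finset.sum_congr rfl fun b hb => ?_
        rw [hu b hb d hd, mul_add, mul_ite, mul_one, mul_zero]
    _ = y d := by
        rw [Finset.sum_add_distrib, ← Finset.sum_mul, hy, zero_mul, add_zero,
          Finset.sum_ite_eq, if_pos hd]

open Classical in
/-- Let `C` be connected by faces, and let every node that lies in exactly one of `C` and `{v, w}`
have a child in `C`. Then the events with `x v = x w` form a realizable support. -/
theorem setOf_eq_mem_realizableSupports {v w : V} (hne : v ≠ w) {C : Finset V}
    (hC : G.BidirectedConnected C)
    (hch : ∀ a, (a ∈ C ↔ a ∉ ({v, w} : Finset V)) → ∃ b ∈ C, G.directed.edge a b) :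
    {x : Event (binaryCard V) | x v = x w} ∈ G.realizableSupports (binaryCard V) := by
  set T : Finset V := {a | a ∈ C ↔ a ∉ ({v, w} : Finset V)} with hT
  have key : ∀ a, ∃ b, a ∈ T → b ∈ C ∧ G.directed.edge a b := by
    intro a
    by_cases ha : a ∈ T
    · obtain ⟨b, hb⟩ := hch a (by simpa [hT] using ha)
      exact ⟨b, fun _ => hb⟩
    · exact ⟨a, fun h => absurd h ha⟩
  choose ch hch' using key
  -- T is the symmetric difference of C and {v, w}, so modulo 2 the sums over C and T add up to the
  -- sum over {v, w}.
  have hparity : ∀ x : V → ZMod 2,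
      ∑ a ∈ C, (x a + ∑ b ∈ T with ch b = a, x b) = x v + x w := by
    intro x
    rw [Finset.sum_add_distrib,
      Finset.sum_fiberwise_of_maps_to (fun b hb => (hch' b hb).1) x, ← Finset.sum_pair hne]
    have h2 : ∀ s : Finset V, ∑ a ∈ s, x a = ∑ a, if a ∈ s then x a else 0 := by
      intro s
      simp
    rw [h2 C, h2 T, h2 {v, w}, ← Finset.sum_add_distrib]
    refine Finset.sum_congr rfl fun a _ => ?_
    have := CharTwo.add_self_eq_zero (x a)
    have haT : a ∈ T ↔ (a ∈ C ↔ a ∉ ({v, w} : Finset V)) := by simp [hT]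
    by_cases h3 : a ∈ C <;> by_cases h4 : a ∈ ({v, w} : Finset V) <;>
      simp only [haT, h3, h4, not_true_eq_false, not_false_eq_true, if_true, if_false, iff_true,
        iff_false, this, add_zero, zero_add]
  let g : V → (V → ZMod 2) → (G.Facet → V → V → ZMod 2) → ZMod 2 → ZMod 2 := fun a x u e =>
    if a ∈ C then G.pairParity C u a + ∑ b ∈ T with ch b = a, x b else e
  have hgC : ∀ a ∈ C, ∀ x u e,
      g a x u e = G.pairParity C u a + ∑ b ∈ T with ch b = a, x b := fun a ha x u e => if_pos ha
  have hgx : ∀ a x x' u e, (∀ b, G.directed.edge b a → x b = x' b) →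
      g a x u e = g a x' u e := by
    intro a x x' u e h
    refine if_congr Iff.rfl (congrArg _ (Finset.sum_congr rfl fun b hb => h b ?_)) rfl
    obtain ⟨hbT, rfl⟩ := Finset.mem_filter.1 hb
    exact (hch' b hbT).2
  have hgu : ∀ a x u u' e, (∀ F : G.Facet, a ∈ F.1 → u F = u' F) →
      g a x u e = g a x u' e := by
    intro a x u u' e h
    simp only [g, G.pairParity_congr C h]
  have hset : ∀ x : V → ZMod 2, x v = x w ↔
      ∃ (u : G.Facet → V → V → ZMod 2) (e : V → ZMod 2), ∀ a, x a = g a x u (e a) := by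
    intro x
    constructor
    · intro hx
      obtain ⟨u, hu⟩ := G.exists_pairParity_eq hC
        (fun a => x a + ∑ b ∈ T with ch b = a, x b)
        (by rw [hparity, hx, CharTwo.add_self_eq_zero])
      -- Nodes outside C copy their error bit, so x itself serves as the errors.
      refine ⟨u, x, fun a => ?_⟩
      by_cases ha : a ∈ C
      · rw [hgC a ha, hu a ha, add_assoc, CharTwo.add_self_eq_zero, add_zero]
      · exact (if_neg ha).symm
    · rintro ⟨u, e, h⟩
      have h0 := G.sum_pairParity C u
      have h1 : ∀ a ∈ C, G.pairParity C u a = x a + ∑ b ∈ T with ch b = a, x b := by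
        intro a ha
        rw [h a, hgC a ha, add_assoc, CharTwo.add_self_eq_zero, add_zero]
      rw [Finset.sum_congr rfl h1, hparity] at h0
      exact CharTwo.add_eq_zero.1 h0
  have hreal := G.setOf_solution_mem_realizableSupports (Λ := V → V → ZMod 2) g hgx hgu
  convert hreal using 1
  exact Set.ext hset

/-- If a pair is densely connected, then the events in which its two variables are equal form a
realizable support. -/
theorem DenselyConnected.setOf_eq_mem_realizableSupports {G : MDAG V} {v w : V}
    (h : G.DenselyConnected v w) :
    {x : Event (binaryCard V) | x v = x w} ∈ G.realizableSupports (binaryCard V) := by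
  classical
  have key : ∀ v w : V, v ≠ w → v ∈ G.directed.parents (G.closure {w}) →
      {x : Event (binaryCard V) | x v = x w} ∈ G.realizableSupports (binaryCard V) := by
    rintro v w hne ⟨b, hb, hvb⟩
    refine G.setOf_eq_mem_realizableSupports hne (C := (G.closure {w}).toFinset) ?_ fun a ha => ?_
    · simpa using G.bidirectedConnected_closure_singleton w
    · simp only [Set.mem_toFinset] at ha ⊢
      by_cases hav : a = v
      · exact ⟨b, hb, hav ▸ hvb⟩
      have haw : a ≠ w := by
        rintro rfl
        simpa using ha.1 (G.subset_closure _ rfl)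
      exact G.exists_edge_of_mem_closure (ha.2 (by simp [hav, haw])) haw
  obtain ⟨hne, h | h | h⟩ := h
  · exact key v w hne h
  · simpa only [eq_comm] using key w v hne.symm h
  · refine G.setOf_eq_mem_realizableSupports hne (C := (G.closure {v, w}).toFinset) ?_ fun a ha => ?_
    · simpa using h
    · simp only [Set.mem_toFinset] at ha ⊢
      by_cases haA : a ∈ ({v, w} : Set V)
      · have h1 : a ∈ ({v, w} : Finset V) := by simpa using haA
        exact absurd h1 (ha.1 (G.subset_closure _ haA))
      · exact G.exists_edge_of_mem_closure (ha.2 (by simpa using haA)) haA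

end MDAG

end CausalStructure

theorem mainTheorem8 {V : Type*} [Fintype V] [DecidableEq V] (G G' : CausalStructure.MDAG V) :
    (CausalStructure.MDAG.NondominanceByDensePairs G G' →
      CausalStructure.MDAG.NondominanceBySupports G G' ∧
      CausalStructure.MDAG.NondominanceBySupportsAt G G' (CausalStructure.binaryCard V)) ∧
    ∀ v w : V, v ≠ w → G'.DenselyConnected v w → ¬ G.DenselyConnected v w →
      CausalStructure.eventSupport (CausalStructure.correlatedPairDist v w) ∈
          G'.realizableSupports (CausalStructure.binaryCard V) ∧
        CausalStructure.eventSupport (CausalStructure.correlatedPairDist v w) ∉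
          G.realizableSupports (CausalStructure.binaryCard V) := by
  have key : ∀ v w : V, v ≠ w → G'.DenselyConnected v w → ¬ G.DenselyConnected v w →
      CausalStructure.eventSupport (CausalStructure.correlatedPairDist v w) ∈
          G'.realizableSupports (CausalStructure.binaryCard V) ∧
        CausalStructure.eventSupport (CausalStructure.correlatedPairDist v w) ∉
          G.realizableSupports (CausalStructure.binaryCard V) := by
    intro v w hne h' h
    rw [CausalStructure.eventSupport_correlatedPairDist]
    exact ⟨h'.setOf_eq_mem_realizableSupports,
      CausalStructure.MDAG.notMem_realizableSupports hne h⟩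
  refine ⟨?_, key⟩
  rintro ⟨v, w, hne, h', h⟩
  have hS : CausalStructure.MDAG.NondominanceBySupportsAt G G' (CausalStructure.binaryCard V) :=
    ⟨_, key v w hne h' h⟩
  exact ⟨⟨_, hS⟩, hS⟩
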